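/- Let $\kappa$ be an infinite regular cardinal. Then the following are equivalent. 1. There is a $\kappa$-Kurepa tree, i.e. a tree $T$ (a partial order in which the set of predecessors of every node is well-ordered) of height $\kappa$, all of whose levels have size less than $\kappa$, with at least $\kappa^+$ different $\kappa$-branches (maximal chains of order type $\kappa$). 2. There is a graph $G$ with exactly $\kappa$ vertices such that * $G$ is $(\kappa,\kappa)$-connected: for every set $S$ of fewer than $\kappa$ vertices, the number of connected components of $G-S$ is non-zero and less than $\kappa$; and * $G$ has a $\kappa$-Kurepa minor family of size at least $\kappa^+$: there is a family $(W_i)_{i\in I}$ with $|I|\ge\kappa^+$, where each $W_i$ is a $K_\kappa$ minor of $G$, i.e. a family $(X^i_\alpha)_{\alpha<\kappa}$ of non-empty, pairwise disjoint vertex sets, each inducing a connected subgraph of $G$, such that for all $\alpha\neq\beta$ some edge of $G$ joins $X^i_\alpha$ to $X^i_\beta$; and for all $i\ne j$ in $I$ there is a set $S$ of fewer than $\kappa$ vertices that separates $\bigcup_{\alpha}X^i_\alpha$ from $\bigcup_\alpha X^j_\alpha$, i.e. no component of $G-S$ contains vertices of both of these sets. -/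

import Mathlib

open Cardinal

universe u

/-- A (set-theoretic) tree: a partial order in which the set of predecessors
`{s | s < t}` of every node `t` is well-ordered. -/
class WellFoundedTree (T : Type u) extends PartialOrder T where
  isWellOrder_pred : ∀ t : T, IsWellOrder (Set.Iio t) (· < ·)

attribute [instance] WellFoundedTree.isWellOrder_pred

namespace WellFoundedTree

/-- The height of a node: the order type of its set of predecessors. -/
noncomputable def ht {T : Type u} [WellFoundedTree T] (t : T) : Ordinal.{u} :=
  Ordinal.type (fun a b : Set.Iio t => a < b)

/-- Level `α` of the tree: the set of nodes of height `α`. -/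
def level (T : Type u) [WellFoundedTree T] (α : Ordinal.{u}) : Set T :=
  {t | ht t = α}

/-- The height of the tree: the least ordinal that exceeds the heights of all nodes. -/
noncomputable def height (T : Type u) [WellFoundedTree T] : Ordinal.{u} :=
  ⨆ t : T, Order.succ (ht t)

/-- A branch is a maximal chain; it is a `κ`-branch if its order type is `κ`. -/
def IsCardBranch {T : Type u} [WellFoundedTree T] (κ : Cardinal.{u}) (B : Set T) : Prop :=
  IsMaxChain (· ≤ ·) B ∧
    ∃ _ : IsWellOrder B (· < ·), Ordinal.type (fun a b : B => a < b) = κ.ord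

/-- A `κ`-Kurepa tree: height `κ`, all levels of size less than `κ`, and at least `κ⁺`
different `κ`-branches. -/
structure IsKurepa (T : Type u) [WellFoundedTree T] (κ : Cardinal.{u}) : Prop where
  height_eq : height T = κ.ord
  card_level_lt : ∀ α : Ordinal.{u}, #(level T α) < κ
  le_card_branches : Order.succ κ ≤ #{B : Set T // IsCardBranch κ B}

end WellFoundedTree

namespace SimpleGraph

/-- `G` is `(κ, μ)`-connected: after the removal of any set of fewer than `κ` vertices the number
of connected components is non-zero and less than `μ`. -/
def IsCardConnected {V : Type u} (G : SimpleGraph V) (κ μ : Cardinal.{u}) : Prop :=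
  ∀ S : Set V, #S < κ →
    #((G.induce Sᶜ).ConnectedComponent) ≠ 0 ∧ #((G.induce Sᶜ).ConnectedComponent) < μ

/-- The family `X` of vertex sets of `G`, indexed by the vertices of `H`, witnesses that `H` is a
minor of `G`: the sets are non-empty, pairwise disjoint, induce connected subgraphs of `G`, and
sets indexed by adjacent vertices of `H` are joined by an edge of `G`. -/
structure IsMinorModel {U V : Type u} (H : SimpleGraph U) (G : SimpleGraph V)
    (X : U → Set V) : Prop where
  nonempty : ∀ a, (X a).Nonempty
  disjoint : ∀ a b, a ≠ b → Disjoint (X a) (X b)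
  connected : ∀ a, (G.induce (X a)).Connected
  adj : ∀ a b, H.Adj a b → ∃ x ∈ X a, ∃ y ∈ X b, G.Adj x y

/-- The complete graph `K_κ`, on the ordinals below `κ`. -/
abbrev cardComplete (κ : Cardinal.{u}) : SimpleGraph κ.ord.ToType := completeGraph _

/-- `S` separates `X` from `Y` in `G`: after the removal of `S`, vertices of `X \ S` and
of `Y \ S` always lie in different components. -/
def SeparatesSets {V : Type u} (G : SimpleGraph V) (S X Y : Set V) : Prop :=
  ∀ x y : (Sᶜ : Set V), (x : V) ∈ X → (y : V) ∈ Y →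
    (G.induce Sᶜ).connectedComponentMk x ≠ (G.induce Sᶜ).connectedComponentMk y

/-- A `κ`-Kurepa minor family in `G` (indexed by `ι`): a family of `K_κ` minors such that the
vertex sets of any two of them are separated by a set of fewer than `κ` vertices. -/
structure IsKurepaMinorFamily {V : Type u} (G : SimpleGraph V) (κ : Cardinal.{u}) {ι : Type u}
    (W : ι → κ.ord.ToType → Set V) : Prop where
  isMinorModel : ∀ i, IsMinorModel (cardComplete κ) G (W i)
  separated : ∀ i j, i ≠ j → ∃ S : Set V, #S < κ ∧ G.SeparatesSets S (⋃ a, W i a) (⋃ a, W j a)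

end SimpleGraph

/-! Both directions match tree levels with deletions of fewer than `κ` vertices; regularity puts any
small vertex set below some level. Given a Kurepa tree, take its comparability graph. A `κ`-branch
is a clique, so its singletons form a `K_κ` minor. Deleting everything below a level leaves no edge
between cones over different nodes of that level, so two branches are separated once they have split
(`exists_separatesSets`). Conversely, enumerate `V` along `κ`. The nodes at index `a` are the
components left after deleting the vertices enumerated before `a`; connectivity gives height `κ` and
small levels. A `K_κ` minor always has a set that avoids the deleted vertices, and all such sets lie
in one component, so the minor selects a branch (`IsMinorModel.exists_branch`). Separated minors
select different branches (`IsKurepaMinorFamily.mk_le_branches`). -/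

namespace WellFoundedTree

/-! ### From a Kurepa tree to its comparability graph -/

section Tree

variable {T : Type u} [WellFoundedTree T]

theorem ht_eq_typein {s t : T} (h : s < t) :
    ht s = Ordinal.typein (fun a b : Set.Iio t => a < b) ⟨s, h⟩ := by
  rw [← Ordinal.type_subrel]
  refine RelIso.ordinalType_congr ⟨⟨fun x => ⟨⟨x.1, x.2.trans h⟩, x.2⟩, fun x => ⟨x.1.1, x.2⟩,
    fun _ => rfl, fun _ => rfl⟩, Iff.rfl⟩

theorem ht_lt_ht {s t : T} (h : s < t) : ht s < ht t := by
  rw [ht_eq_typein h]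
  exact Ordinal.typein_lt_type _ _

theorem ht_le_ht {s t : T} (h : s ≤ t) : ht s ≤ ht t := by
  rcases h.eq_or_lt with rfl | h
  · exact le_rfl
  · exact (ht_lt_ht h).le

theorem exists_le_ht_eq {t : T} {α : Ordinal.{u}} (h : α ≤ ht t) : ∃ s ≤ t, ht s = α := by
  rcases h.eq_or_lt with rfl | h
  · exact ⟨t, le_rfl, rfl⟩
  · obtain ⟨s, hs⟩ := Ordinal.typein_surj (fun a b : Set.Iio t => a < b) h
    exact ⟨s.1, le_of_lt s.2, by rw [ht_eq_typein s.2]; exact hs⟩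

theorem le_or_le_of_le {r s t : T} (hr : r ≤ t) (hs : s ≤ t) : r ≤ s ∨ s ≤ r := by
  rcases hr.eq_or_lt with rfl | hr
  · exact Or.inr hs
  rcases hs.eq_or_lt with rfl | hs
  · exact Or.inl hr.le
  rcases trichotomous_of (fun a b : Set.Iio t => a < b) ⟨r, hr⟩ ⟨s, hs⟩ with h | h | h
  · exact Or.inl (le_of_lt (show r < s from h))
  · exact Or.inl (congrArg Subtype.val h).le
  · exact Or.inr (le_of_lt (show s < r from h))

theorem eq_of_comparable_of_ht_eq {r s : T} (h : r ≤ s ∨ s ≤ r) (he : ht r = ht s) : r = s := by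
  rcases h with h | h
  · exact h.eq_or_lt.resolve_right fun h => (ht_lt_ht h).ne he
  · exact (h.eq_or_lt.resolve_right fun h => (ht_lt_ht h).ne he.symm).symm

theorem mem_of_le_of_isMaxChain {B : Set T} (hB : IsMaxChain (· ≤ ·) B) {s t : T} (ht : t ∈ B)
    (h : s ≤ t) : s ∈ B := by
  have hc : IsChain (· ≤ ·) (insert s B) := by
    refine hB.1.insert fun c hc _ => ?_
    rcases hB.1.total ht hc with h' | h'
    · exact Or.inl (h.trans h')
    · exact le_or_le_of_le h h'
  rw [hB.2 hc (Set.subset_insert s B)]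
  exact Set.mem_insert s B

theorem IsKurepa.ht_lt {κ : Cardinal.{u}} (hT : IsKurepa T κ) (t : T) : ht t < κ.ord := by
  rw [← hT.height_eq]
  exact (Order.lt_succ _).trans_le (Ordinal.le_iSup (fun t : T => Order.succ (ht t)) t)

theorem IsKurepa.card_ht_lt {κ : Cardinal.{u}} (hκ : κ.IsRegular) (hT : IsKurepa T κ)
    {α : Ordinal.{u}} (hα : α < κ.ord) : #{t : T | ht t < α} < κ := by
  have hU : {t : T | ht t < α} ⊆
      ⋃ i : α.ToType, level T (Ordinal.typein (α := α.ToType) (· < ·) i) := by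
    intro t hlt
    obtain ⟨i, hi⟩ := Ordinal.typein_surj (α := α.ToType) (· < ·)
      (show ht t < _ by rw [Ordinal.type_toType]; exact hlt)
    exact Set.mem_iUnion.2 ⟨i, hi.symm⟩
  refine (mk_le_mk_of_subset hU).trans_lt ?_
  rw [card_iUnion_lt_iff_forall_of_isRegular hκ (by rw [mk_toType]; exact lt_ord.1 hα)]
  exact fun i => hT.card_level_lt _

theorem IsKurepa.mk_eq {κ : Cardinal.{u}} (hκ : κ.IsRegular) (hT : IsKurepa T κ) : #T = κ := by
  apply le_antisymm
  · have hU : (Set.univ : Set T) ⊆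
        ⋃ i : κ.ord.ToType, level T (Ordinal.typein (α := κ.ord.ToType) (· < ·) i) := by
      intro t _
      obtain ⟨i, hi⟩ := Ordinal.typein_surj (α := κ.ord.ToType) (· < ·)
        (show _ < _ by rw [Ordinal.type_toType]; exact hT.ht_lt t)
      exact Set.mem_iUnion.2 ⟨i, hi.symm⟩
    rw [← mk_univ]
    refine (mk_le_mk_of_subset hU).trans ((mk_iUnion_le _).trans ?_)
    rw [mk_ord_toType]
    refine (mul_le_mul_right (ciSup_le' fun i => (hT.card_level_lt _).le) κ).trans ?_
    exact (mul_eq_self hκ.aleph0_le).le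
  · have hne : #{B : Set T // IsCardBranch κ B} ≠ 0 :=
      (pos_of_gt (Order.succ_le_iff.1 hT.le_card_branches)).ne'
    obtain ⟨B, _, hB, hBt⟩ := mk_ne_zero_iff.1 hne
    have := congrArg Ordinal.card hBt
    rw [Ordinal.card_type, card_ord] at this
    rw [← this]
    exact mk_set_le B

theorem exists_forall_ht_lt {κ : Cardinal.{u}} (hκ : κ.IsRegular) (hT : IsKurepa T κ)
    {S : Set T} (hS : #S < κ) : ∃ α < κ.ord, ∀ t ∈ S, ht t < α := by
  refine ⟨⨆ t : S, (ht t.1 + 1), ?_, fun t ht => ?_⟩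
  · exact Ordinal.iSup_add_one_lt_of_lt_cof (by rwa [hκ.cof_ord]) fun t => hT.ht_lt t.1
  · exact Ordinal.lt_iSup_add_one (f := fun t : S => WellFoundedTree.ht t.1) ⟨t, ht⟩

variable (T) in
/-- The comparability graph of a tree. -/
def comparabilityGraph : SimpleGraph T where
  Adj s t := s < t ∨ t < s
  symm := ⟨fun _ _ h => h.symm⟩
  loopless := ⟨fun _ h => h.elim (lt_irrefl _) (lt_irrefl _)⟩

theorem isCardConnected_comparabilityGraph {κ : Cardinal.{u}} (hκ : κ.IsRegular)
    (hT : IsKurepa T κ) : (comparabilityGraph T).IsCardConnected κ κ := by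
  intro S hS
  constructor
  · rw [mk_ne_zero_iff]
    have : (Sᶜ : Set T).Nonempty := by
      rw [Set.nonempty_compl]
      rintro rfl
      rw [mk_univ, hT.mk_eq hκ] at hS
      exact hS.false
    exact ⟨SimpleGraph.connectedComponentMk _ ⟨_, this.some_mem⟩⟩
  · obtain ⟨α, hα, hSα⟩ := exists_forall_ht_lt hκ hT hS
    -- A component may miss all heights below `α`, but then it contains a node of height exactly
    -- `α`. Hence representatives are sought below `succ α`.
    have hα' : Order.succ α < κ.ord := (isSuccLimit_ord hκ.aleph0_le).succ_lt hα
    refine lt_of_le_of_lt ?_ (hT.card_ht_lt hκ hα')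
    have key : ∀ C : ((comparabilityGraph T).induce Sᶜ).ConnectedComponent,
        ∃ t : (Sᶜ : Set T), ht t.1 < Order.succ α ∧ SimpleGraph.connectedComponentMk _ t = C := by
      intro C
      induction C using SimpleGraph.ConnectedComponent.ind with
      | h v =>
        rcases lt_or_ge (ht v.1) α with h | h
        · exact ⟨v, h.trans (Order.lt_succ α), rfl⟩
        · obtain ⟨s, hs, hsα⟩ := exists_le_ht_eq h
          have hsS : s ∈ Sᶜ := fun hsS => (hSα s hsS).ne hsα
          refine ⟨⟨s, hsS⟩, hsα.trans_lt (Order.lt_succ α), ?_⟩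
          rcases hs.eq_or_lt with rfl | hs
          · rfl
          · exact SimpleGraph.ConnectedComponent.connectedComponentMk_eq_of_adj
              (show (comparabilityGraph T).Adj _ _ from Or.inl hs)
    choose g hg hgC using key
    refine mk_le_of_injective (f := fun C => (⟨(g C).1, hg C⟩ : {t : T | ht t < Order.succ α})) ?_
    intro C D h
    have h' : (g C).1 = (g D).1 := Subtype.mk.inj h
    rw [← hgC C, ← hgC D, Subtype.ext h']

/-- No edge leaves the cone above `r`: if `s < t` and `r ≤ t`, then `r` and `s` are comparable, and
`s` survives only at height at least that of `r`. -/
theorem le_iff_le_of_reachable {α : Ordinal.{u}} {S : Set T} (hS : ∀ t, t ∉ S → α ≤ ht t)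
    {r : T} (hr : ht r = α) {s t : (Sᶜ : Set T)}
    (h : ((comparabilityGraph T).induce Sᶜ).Reachable s t) : r ≤ s.1 ↔ r ≤ t.1 := by
  have step : ∀ s t : T, s ∉ S → s < t → (r ≤ s ↔ r ≤ t) := by
    intro s t hs hst
    refine ⟨fun h => h.trans hst.le, fun h => ?_⟩
    rcases le_or_le_of_le h hst.le with h' | h'
    · exact h'
    · exact (eq_of_comparable_of_ht_eq (Or.inl h')
        (le_antisymm (ht_le_ht h') (hr.trans_le (hS s hs)))).ge
  obtain ⟨p⟩ := h
  induction p with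
  | nil => rfl
  | @cons a b c hab _ ih =>
    refine Iff.trans ?_ ih
    rcases (show a.1 < b.1 ∨ b.1 < a.1 from hab) with h | h
    · exact step _ _ a.2 h
    · exact (step _ _ b.2 h).symm

theorem exists_separatesSets {κ : Cardinal.{u}} (hκ : κ.IsRegular) (hT : IsKurepa T κ)
    {B C : Set T} (hB : IsMaxChain (· ≤ ·) B) (hC : IsMaxChain (· ≤ ·) C) (hBC : B ≠ C) :
    ∃ S : Set T, #S < κ ∧ (comparabilityGraph T).SeparatesSets S B C := by
  obtain ⟨x, hxB, hxC⟩ : ∃ x ∈ B, x ∉ C :=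
    Set.not_subset.1 fun h => hBC (hB.2 hC.1 h)
  -- What remains of `B` lies in the cone above `x`; `C` misses this cone because it is downward
  -- closed.
  refine ⟨{t | ht t < ht x}, hT.card_ht_lt hκ (hT.ht_lt x), ?_⟩
  intro b c hb hc hbc
  have hS : ∀ t, t ∉ {t : T | ht t < ht x} → ht x ≤ ht t := fun t h => not_lt.1 h
  have hxb : x ≤ b.1 := by
    rcases hB.1.total hxB hb with h | h
    · exact h
    · exact (eq_of_comparable_of_ht_eq (Or.inl h)
        (le_antisymm (ht_le_ht h) (hS _ b.2))).ge
  have hxc := (le_iff_le_of_reachable hS rfl (SimpleGraph.ConnectedComponent.exact hbc)).1 hxb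
  exact hxC (mem_of_le_of_isMaxChain hC hc hxc)

theorem exists_isKurepaMinorFamily {κ : Cardinal.{u}} (hκ : κ.IsRegular) (hT : IsKurepa T κ) :
    ∃ W : {B : Set T // IsCardBranch κ B} → κ.ord.ToType → Set T,
      (comparabilityGraph T).IsKurepaMinorFamily κ W := by
  have key : ∀ B : {B : Set T // IsCardBranch κ B}, Nonempty (κ.ord.ToType ≃ B.1) := by
    rintro ⟨B, _, hB, hBt⟩
    have := congrArg Ordinal.card hBt
    rw [Ordinal.card_type, card_ord] at this
    rw [← Cardinal.eq, mk_ord_toType, this]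
  have e := fun B => (key B).some
  refine ⟨fun B a => {(e B a).1}, fun B => ⟨fun a => Set.singleton_nonempty _, fun a b hab => ?_,
    fun a => ?_, fun a b hab => ⟨_, rfl, _, rfl, ?_⟩⟩, fun B C hBC => ?_⟩
  · rw [Set.disjoint_singleton]
    exact fun h => hab ((e B).injective (Subtype.ext h))
  · exact SimpleGraph.Connected.of_subsingleton
  · have hne : (e B a).1 ≠ (e B b).1 := fun h => hab ((e B).injective (Subtype.ext h))
    rcases B.2.1.1.total (e B a).2 (e B b).2 with h | h
    · exact Or.inl (h.lt_of_ne hne)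
    · exact Or.inr (h.lt_of_ne hne.symm)
  · have hU : ∀ B : {B : Set T // IsCardBranch κ B}, ⋃ a, {(e B a).1} = B.1 := by
      intro B
      ext t
      simp only [Set.mem_iUnion, Set.mem_singleton_iff]
      refine ⟨?_, fun h => ⟨(e B).symm ⟨t, h⟩, by simp⟩⟩
      rintro ⟨a, rfl⟩
      exact (e B a).2
    rw [hU, hU]
    exact exists_separatesSets hκ hT B.2.1 C.2.1 fun h => hBC (Subtype.ext h)

end Tree

section Rank

/-- A strictly monotone map of a partial order to a linear order which takes the predecessors of
`t` bijectively to the elements below the image of `t` is an order isomorphism there. -/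
noncomputable def iioRelIso {T K : Type u} [PartialOrder T] [LinearOrder K] (ρ : T → K)
    (hmono : ∀ s t, s < t → ρ s < ρ t) (hex : ∀ t, ∀ a < ρ t, ∃ s < t, ρ s = a)
    (huniq : ∀ r s t, r ≤ t → s ≤ t → ρ r = ρ s → r = s) (t : T) :
    (fun a b : Set.Iio t => a < b) ≃r (fun a b : Set.Iio (ρ t) => a < b) where
  toEquiv := Equiv.ofBijective (fun s => ⟨ρ s.1, hmono _ _ s.2⟩)
    ⟨fun r s h => Subtype.ext (huniq _ _ t (le_of_lt r.2) (le_of_lt s.2) (congrArg Subtype.val h)),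
      fun a => by
        obtain ⟨s, hs, hsa⟩ := hex t a.1 a.2
        exact ⟨⟨s, hs⟩, Subtype.ext hsa⟩⟩
  map_rel_iff' := by
    intro r s
    refine ⟨fun h => ?_, fun h => hmono _ _ h⟩
    obtain ⟨q, hq, hqr⟩ := hex s.1 (ρ r.1) h
    have : q = r.1 := huniq _ _ t (hq.le.trans (le_of_lt s.2)) (le_of_lt r.2) hqr
    subst this
    exact hq

end Rank

end WellFoundedTree

/-! ### The tree of components along an enumeration -/

namespace SimpleGraph

/-- The nodes of the component tree of `G` along `f : V → K`: the components of the subgraphs of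
`G` induced by the sets `{v | ¬ f v < a}`. -/
structure ComponentTree {V K : Type u} [LT K] (G : SimpleGraph V) (f : V → K) where
  /-- The index of the node. -/
  fst : K
  /-- The component. -/
  component : (G.induce {v | f v < fst}ᶜ).ConnectedComponent

namespace ComponentTree

variable {V K : Type u} [LinearOrder K] {G : SimpleGraph V} {f : V → K}

/-- The vertex set of a node of the component tree. -/
def verts (x : ComponentTree G f) : Set V := Subtype.val '' x.2.supp

/-- The node at `a` which contains the vertex `v`. -/
def node (G : SimpleGraph V) (f : V → K) (a : K) (v : V) (hv : ¬ f v < a) : ComponentTree G f :=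
  ⟨a, (G.induce {v | f v < a}ᶜ).connectedComponentMk ⟨v, hv⟩⟩

theorem exists_eq_node (x : ComponentTree G f) : ∃ v hv, x = node G f x.1 v hv := by
  obtain ⟨a, C⟩ := x
  induction C using ConnectedComponent.ind with
  | h v => exact ⟨v.1, v.2, rfl⟩

theorem mem_verts_node {a : K} {v w : V} {hv : ¬ f v < a} :
    w ∈ (node G f a v hv).verts ↔
      ∃ hw : ¬ f w < a, (G.induce {v | f v < a}ᶜ).Reachable ⟨w, hw⟩ ⟨v, hv⟩ := by
  constructor
  · rintro ⟨w, hw, rfl⟩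
    exact ⟨w.2, ConnectedComponent.exact hw⟩
  · rintro ⟨hw, h⟩
    exact ⟨⟨w, hw⟩, ConnectedComponent.sound h, rfl⟩

theorem self_mem_verts_node {a : K} {v : V} {hv : ¬ f v < a} : v ∈ (node G f a v hv).verts :=
  mem_verts_node.2 ⟨hv, .rfl⟩

theorem eq_node_of_mem {x : ComponentTree G f} {v : V} (h : v ∈ x.verts) :
    ∃ hv, x = node G f x.1 v hv := by
  obtain ⟨a, C⟩ := x
  obtain ⟨v, hv, rfl⟩ := h
  exact ⟨v.2, by rw [← show _ = C from hv]; rfl⟩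

theorem eq_of_mem {x y : ComponentTree G f} (h : x.1 = y.1) {v : V} (hx : v ∈ x.verts)
    (hy : v ∈ y.verts) : x = y := by
  obtain ⟨h1, h2⟩ := eq_node_of_mem hx
  obtain ⟨h3, h4⟩ := eq_node_of_mem hy
  rw [h2, h4]
  congr 1

theorem verts_nonempty (x : ComponentTree G f) : x.verts.Nonempty := by
  obtain ⟨v, hv, h⟩ := exists_eq_node x
  exact ⟨v, h ▸ self_mem_verts_node⟩

theorem reachable_induce_compl_mono {S S' : Set V} (h : S ⊆ S') {x y : (S'ᶜ : Set V)}
    (hxy : (G.induce S'ᶜ).Reachable x y) :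
    (G.induce Sᶜ).Reachable ⟨x.1, fun hx => x.2 (h hx)⟩ ⟨y.1, fun hy => y.2 (h hy)⟩ :=
  hxy.map (induceHomOfLE G (Set.compl_subset_compl.2 h)).toHom

theorem verts_node_subset {a b : K} (h : a ≤ b) {v : V} (hv : ¬ f v < b) :
    (node G f b v hv).verts ⊆ (node G f a v fun h' => hv (h'.trans_le h)).verts := by
  intro w hw
  obtain ⟨hw, hr⟩ := mem_verts_node.1 hw
  exact mem_verts_node.2 ⟨fun h' => hw (h'.trans_le h),
    reachable_induce_compl_mono (fun u (hu : f u < a) => hu.trans_le h) hr⟩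

/-- Indices are compared too, since one vertex set can be a component at several indices. -/
instance : PartialOrder (ComponentTree G f) where
  le x y := x.1 ≤ y.1 ∧ y.verts ⊆ x.verts
  le_refl x := ⟨le_rfl, subset_rfl⟩
  le_trans x y z h h' := ⟨h.1.trans h'.1, h'.2.trans h.2⟩
  le_antisymm x y h h' := by
    obtain ⟨v, hv⟩ := x.verts_nonempty
    exact eq_of_mem (le_antisymm h.1 h'.1) hv (h'.2 hv)

theorem le_def {x y : ComponentTree G f} : x ≤ y ↔ x.1 ≤ y.1 ∧ y.verts ⊆ x.verts := Iff.rfl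

theorem eq_of_le_of_fst_eq {x y z : ComponentTree G f} (hx : x ≤ z) (hy : y ≤ z)
    (h : x.1 = y.1) : x = y := by
  obtain ⟨v, hv⟩ := z.verts_nonempty
  exact eq_of_mem h (hx.2 hv) (hy.2 hv)

theorem fst_lt_fst {x y : ComponentTree G f} (h : x < y) : x.1 < y.1 :=
  (le_def.1 h.le).1.lt_of_ne fun he => h.ne (eq_of_le_of_fst_eq h.le le_rfl he)

theorem exists_lt_fst_eq (x : ComponentTree G f) (a : K) (ha : a < x.1) : ∃ y < x, y.1 = a := by
  obtain ⟨v, hv, h⟩ := exists_eq_node x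
  refine ⟨node G f a v fun h' => hv (h'.trans ha), lt_of_le_of_ne ⟨ha.le, ?_⟩ ?_, rfl⟩
  · exact (congrArg verts h).subset.trans (verts_node_subset ha.le hv)
  · exact fun he => ha.ne (congrArg fst he)

/-- The predecessors of a node of the component tree correspond to the indices below its own. -/
noncomputable def iioRelIso (x : ComponentTree G f) :
    (fun a b : Set.Iio x => a < b) ≃r (fun a b : Set.Iio x.1 => a < b) :=
  WellFoundedTree.iioRelIso (fun x : ComponentTree G f => x.1) (fun _ _ => fst_lt_fst)
    exists_lt_fst_eq (fun _ _ _ => eq_of_le_of_fst_eq) x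

/-- Comparable nodes of equal index coincide, so a chain with a node at every index cannot be
extended. -/
theorem isMaxChain_range {n : K → ComponentTree G f} (hn : ∀ a, (n a).1 = a) (hm : Monotone n) :
    IsMaxChain (· ≤ ·) (Set.range n) := by
  refine ⟨?_, fun C hC hs => hs.antisymm fun y hy => ⟨y.1, ?_⟩⟩
  · rintro _ ⟨a, rfl⟩ _ ⟨b, rfl⟩ _
    exact (le_total a b).imp (fun h => hm h) (fun h => hm h)
  · rcases hC.total (hs ⟨y.1, rfl⟩) hy with h | h
    · exact eq_of_le_of_fst_eq h le_rfl (hn _)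
    · exact (eq_of_le_of_fst_eq h le_rfl (hn _).symm).symm

variable [WellFoundedLT K]

noncomputable instance : WellFoundedTree (ComponentTree G f) where
  isWellOrder_pred x := (iioRelIso x).toRelEmbedding.isWellOrder

theorem ht_eq (x : ComponentTree G f) :
    WellFoundedTree.ht x = Ordinal.typein (fun a b : K => a < b) x.1 := by
  rw [← Ordinal.type_subrel]
  exact (iioRelIso x).ordinalType_congr

theorem level_subset_range (x : ComponentTree G f) :
    WellFoundedTree.level (ComponentTree G f) (WellFoundedTree.ht x) ⊆
      Set.range (fun C => (⟨x.1, C⟩ : ComponentTree G f)) := by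
  rintro ⟨a, C⟩ h
  have h' : WellFoundedTree.ht _ = _ := h
  rw [ht_eq, ht_eq, Ordinal.typein_inj] at h'
  obtain rfl : a = x.1 := h'
  exact ⟨C, rfl⟩

theorem isCardBranch_range {κ : Cardinal.{u}} {f : V → κ.ord.ToType}
    {n : κ.ord.ToType → ComponentTree G f} (hn : ∀ a, (n a).1 = a) (hm : Monotone n) :
    WellFoundedTree.IsCardBranch κ (Set.range n) := by
  have hinj : Function.Injective n := fun a b h => by rw [← hn a, ← hn b, h]
  have hs : StrictMono n := hm.strictMono_of_injective hinj
  let e : (fun a b : κ.ord.ToType => a < b) ≃r (fun a b : Set.range n => a < b) :=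
    ⟨Equiv.ofInjective n hinj, fun {a b} => hs.lt_iff_lt⟩
  have hw : IsWellOrder (Set.range n) (fun a b : Set.range n => a < b) :=
    e.symm.toRelEmbedding.isWellOrder
  exact ⟨isMaxChain_range hn hm, hw, e.ordinalType_congr.symm.trans (Ordinal.type_toType _)⟩

end ComponentTree

/-! ### From a Kurepa minor family to branches -/

section Kurepa

variable {V : Type u} {G : SimpleGraph V} {κ : Cardinal.{u}}

theorem mk_setOf_apply_lt (f : V ≃ κ.ord.ToType) (a : κ.ord.ToType) : #{v | f v < a} < κ :=
  (mk_preimage_of_injective f (Set.Iio a) f.injective).trans_lt <|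
    (mk_Iio_lt a (by rw [mk_ord_toType, Ordinal.type_toType])).trans_eq (mk_ord_toType κ)

theorem height_componentTree (f : V ≃ κ.ord.ToType) (hG : G.IsCardConnected κ κ) :
    WellFoundedTree.height (ComponentTree G f) = κ.ord := by
  apply le_antisymm
  · refine Ordinal.iSup_le fun x => ?_
    rw [Order.succ_le_iff, ComponentTree.ht_eq]
    exact Ordinal.typein_lt_self _
  · by_contra! hlt
    obtain ⟨a, ha⟩ := Ordinal.typein_surj (α := κ.ord.ToType) (· < ·)
      (show _ < _ by rw [Ordinal.type_toType]; exact hlt)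
    obtain ⟨C⟩ := mk_ne_zero_iff.1 (hG _ (mk_setOf_apply_lt f a)).1
    have h := Ordinal.le_iSup (fun x : ComponentTree G f => Order.succ (WellFoundedTree.ht x))
      ⟨a, C⟩
    rw [ComponentTree.ht_eq, Order.succ_le_iff] at h
    exact h.ne ha

theorem card_level_componentTree_lt (hκ : κ.IsRegular) (f : V ≃ κ.ord.ToType)
    (hG : G.IsCardConnected κ κ) (α : Ordinal.{u}) :
    #(WellFoundedTree.level (ComponentTree G f) α) < κ := by
  rcases (WellFoundedTree.level (ComponentTree G f) α).eq_empty_or_nonempty with h | ⟨x, rfl⟩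
  · rw [h, mk_eq_zero]
    exact hκ.pos
  · exact ((mk_le_mk_of_subset x.level_subset_range).trans mk_range_le).trans_lt
      (hG _ (mk_setOf_apply_lt f x.1)).2

theorem IsMinorModel.reachable {X : κ.ord.ToType → Set V} (hX : IsMinorModel (cardComplete κ) G X)
    {S : Set V} {a b : κ.ord.ToType} (ha : X a ⊆ Sᶜ) (hb : X b ⊆ Sᶜ) {x y : V} (hx : x ∈ X a)
    (hy : y ∈ X b) : (G.induce Sᶜ).Reachable ⟨x, ha hx⟩ ⟨y, hb hy⟩ := by
  have within : ∀ c (hc : X c ⊆ Sᶜ) x y (hx : x ∈ X c) (hy : y ∈ X c),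
      (G.induce Sᶜ).Reachable ⟨x, hc hx⟩ ⟨y, hc hy⟩ := fun c hc x y hx hy =>
    ((hX.connected c).preconnected ⟨x, hx⟩ ⟨y, hy⟩).map (induceHomOfLE G hc).toHom
  rcases eq_or_ne a b with rfl | hab
  · exact within a ha x y hx hy
  · obtain ⟨u, hu, v, hv, huv⟩ := hX.adj a b hab
    have huv' : (G.induce Sᶜ).Adj ⟨u, ha hu⟩ ⟨v, hb hv⟩ := huv
    exact ((within a ha x u hx hu).trans huv'.reachable).trans (within b hb v y hv hy)

/-- Otherwise `S` would meet each of `κ` disjoint sets. -/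
theorem IsMinorModel.exists_subset_compl {X : κ.ord.ToType → Set V}
    (hX : IsMinorModel (cardComplete κ) G X) {S : Set V} (hS : #S < κ) : ∃ a, X a ⊆ Sᶜ := by
  by_contra! h
  have h' : ∀ a, ∃ v ∈ X a, v ∈ S := fun a => by
    obtain ⟨v, hv, hvS⟩ := Set.not_subset.1 (h a)
    exact ⟨v, hv, not_not.1 hvS⟩
  choose v hv hvS using h'
  have hinj : Function.Injective fun a => (⟨v a, hvS a⟩ : S) := by
    intro a b hab
    by_contra hne
    exact Set.disjoint_left.1 (hX.disjoint a b hne) (hv a)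
      (by rw [show v a = v b from congrArg Subtype.val hab]; exact hv b)
  have := mk_le_of_injective hinj
  rw [mk_ord_toType] at this
  exact this.not_gt hS

theorem exists_subset_setOf_apply_lt (hκ : κ.IsRegular) (f : V ≃ κ.ord.ToType) {S : Set V}
    (hS : #S < κ) : ∃ a, S ⊆ {v | f v < a} := by
  let g : S → Ordinal.{u} := fun v => Ordinal.typein (α := κ.ord.ToType) (· < ·) (f v.1)
  have hlt : ⨆ v, (g v + 1) < κ.ord :=
    Ordinal.iSup_add_one_lt_of_lt_cof (by rwa [hκ.cof_ord]) fun v => Ordinal.typein_lt_self _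
  obtain ⟨a, ha⟩ := Ordinal.typein_surj (α := κ.ord.ToType) (· < ·)
    (show _ < _ by rw [Ordinal.type_toType]; exact hlt)
  refine ⟨a, fun v hv => ?_⟩
  have : g ⟨v, hv⟩ < Ordinal.typein (α := κ.ord.ToType) (· < ·) a := by
    rw [ha]
    exact Ordinal.lt_iSup_add_one (f := g) ⟨v, hv⟩
  exact (Ordinal.typein_lt_typein (α := κ.ord.ToType) (· < ·)).1 this

/-- The components that contain almost all of a `K_κ` minor form a `κ`-branch of the component
tree. -/
theorem IsMinorModel.exists_branch (f : V ≃ κ.ord.ToType) {X : κ.ord.ToType → Set V}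
    (hX : IsMinorModel (cardComplete κ) G X) :
    ∃ n : κ.ord.ToType → ComponentTree G f, (∀ a, (n a).1 = a) ∧ Monotone n ∧
      ∀ a, ∃ v ∈ ⋃ b, X b, v ∈ (n a).verts := by
  choose b hb using fun a => hX.exists_subset_compl (mk_setOf_apply_lt f a)
  choose v hv using fun a => hX.nonempty (b a)
  refine ⟨fun a => ComponentTree.node G f a (v a) (hb a (hv a)), fun a => rfl, fun a a' h => ⟨h, ?_⟩,
    fun a => ⟨v a, Set.mem_iUnion.2 ⟨b a, hv a⟩, ComponentTree.self_mem_verts_node⟩⟩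
  refine (ComponentTree.verts_node_subset h _).trans (le_of_eq ?_)
  have hsub : {v | f v < a} ⊆ {v | f v < a'} := fun u (hu : f u < a) => hu.trans_le h
  -- The set chosen at `a'` also avoids the smaller deletion at `a`, so both chosen sets lie in one
  -- component there.
  have hr := hX.reachable ((hb a').trans (Set.compl_subset_compl.2 hsub)) (hb a) (hv a') (hv a)
  congr 1
  exact ComponentTree.eq_of_mem rfl ComponentTree.self_mem_verts_node
    (ComponentTree.mem_verts_node.2 ⟨_, hr⟩)

theorem IsKurepaMinorFamily.mk_le_branches (hκ : κ.IsRegular) (f : V ≃ κ.ord.ToType) {ι : Type u}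
    {W : ι → κ.ord.ToType → Set V} (hW : G.IsKurepaMinorFamily κ W) :
    #ι ≤ #{B : Set (ComponentTree G f) // WellFoundedTree.IsCardBranch κ B} := by
  choose n hn hm hv using fun i => (hW.isMinorModel i).exists_branch f
  refine mk_le_of_injective
    (f := fun i => ⟨Set.range (n i), ComponentTree.isCardBranch_range (hn i) (hm i)⟩) ?_
  intro i j hij
  by_contra hne
  obtain ⟨S, hS, hsep⟩ := hW.separated i j hne
  obtain ⟨a, ha⟩ := exists_subset_setOf_apply_lt hκ f hS
  obtain ⟨x, hx, hxa⟩ := hv i a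
  obtain ⟨y, hy, hya⟩ := hv j a
  -- Equal branches share their node at `a`, which then meets both minors although the deletion at
  -- `a` contains the separator `S`.
  have hmem : n i a ∈ Set.range (n j) := (congrArg Subtype.val hij).subset ⟨a, rfl⟩
  obtain ⟨b, hb⟩ := hmem
  obtain rfl : b = a := by rw [← hn j b, hb, hn]
  rw [hb] at hya
  obtain ⟨hy', he⟩ := ComponentTree.eq_node_of_mem hya
  rw [he] at hxa
  obtain ⟨hx', hr⟩ := ComponentTree.mem_verts_node.1 hxa
  rw [← hn i b] at ha
  exact hsep ⟨x, fun h => hx' (ha h)⟩ ⟨y, fun h => hy' (ha h)⟩ hx hy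
    (ConnectedComponent.sound (ComponentTree.reachable_induce_compl_mono ha hr))

end Kurepa

end SimpleGraph

theorem mainTheorem5 (κ : Cardinal.{u}) (hκ : κ.IsRegular) :
    (∃ (T : Type u) (_ : WellFoundedTree T), WellFoundedTree.IsKurepa T κ) ↔
      ∃ (V : Type u) (G : SimpleGraph V),
        #V = κ ∧ G.IsCardConnected κ κ ∧
          ∃ (ι : Type u) (W : ι → κ.ord.ToType → Set V),
            Order.succ κ ≤ #ι ∧ G.IsKurepaMinorFamily κ W := by
  constructor
  · rintro ⟨T, _, hT⟩
    obtain ⟨W, hW⟩ := WellFoundedTree.exists_isKurepaMinorFamily hκ hT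
    exact ⟨T, WellFoundedTree.comparabilityGraph T, hT.mk_eq hκ,
      WellFoundedTree.isCardConnected_comparabilityGraph hκ hT, _, W, hT.le_card_branches, hW⟩
  · rintro ⟨V, G, hV, hG, ι, W, hι, hW⟩
    obtain ⟨f⟩ : Nonempty (V ≃ κ.ord.ToType) := by rw [← Cardinal.eq, hV, mk_ord_toType]
    exact ⟨SimpleGraph.ComponentTree G f, inferInstance,
      SimpleGraph.height_componentTree f hG, SimpleGraph.card_level_componentTree_lt hκ f hG,
      hι.trans (hW.mk_le_branches hκ f)⟩
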